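/- For $n\ge 1$ the Houghton group $H_n$ is the group of all permutations $\phi$ of $\mathbb N\times\{1,\dots,n\}$, $\mathbb N=\{0,1,2,\dots\}$ (a disjoint union of $n$ rays), for which there are constants $s(1),\dots,s(n)\in\mathbb Z$ with $\phi(j,l)=(j+s(l),l)$ for all but finitely many $(j,l)$. In $H_2$ let $s$ be the shift given by $s(j,1)=(j-1,1)$ for $j\ge 1$, $s(0,1)=(0,2)$, $s(j,2)=(j+1,2)$, let $\sigma$ be the transposition of $(0,1)$ and $(0,2)$, and let $X=\{s,\sigma\}$. Number the points of one ray by $1,2,3,\dots$ and those of the other by $-1,-2,-3,\dots$, so that $(-j,j)$ denotes the transposition of $(j-1,1)$ and $(j-1,2)$, and put $g_k=(-k,k)(-(k-1),k-1)\cdots(-1,1)\in H_2$. For a group $G$ generated by $X$, let $d_X(1,g)$ be the least length of a word in $X\cup X^{-1}$ representing $g$, let $d_X(g,h)=d_X(1,g^{-1}h)$, and let $B_g(r)$ be the closed ball of radius $r$ with center $g$. An element $g$ with $n=d_X(1,g)$ is a dead end if $B_g(1)\subseteq B_1(n)$, and its depth is $\max\{l : B_g(l)\subseteq B_1(n)\}$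 (or $\infty$ if there is no maximum). Theorem 3. The set $X=\{s,\sigma\}$ generates $H_2$, and the following hold with respect to $X$. 1. For every $k\ge 1$, $d_X(1,g_k)=1+\sum_{l=2}^{k}(8l-5)$. 2. For every $k\ge 2$, the element $g_k$ is a dead end of depth at least $k$. 3. Hence $H_2$ has unbounded dead-end depth: for every $N$ there is a dead end of depth at least $N$. -/

import Mathlib

/-- The length of `g` with respect to `X`: the least length of a word in the letters `X ∪ X⁻¹`
that represents `g` (meaningful for every `g` when `X` generates the group). -/
noncomputable def wordLength {G : Type*} [Group G] (X : Set G) (g : G) : ℕ :=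
  sInf {n : ℕ | ∃ w : List G, (∀ x ∈ w, x ∈ X ∨ x⁻¹ ∈ X) ∧ w.prod = g ∧ w.length = n}

/-- The distance in the Cayley graph of `G` with respect to `X` (edges join `g` and `g * x`). -/
noncomputable def wordDist {G : Type*} [Group G] (X : Set G) (g h : G) : ℕ :=
  wordLength X (g⁻¹ * h)

/-- The closed ball with center `g` and radius `r` in the Cayley graph. -/
def wordBall {G : Type*} [Group G] (X : Set G) (g : G) (r : ℕ) : Set G :=
  {h | wordDist X g h ≤ r}

/-- `g` is a dead end: the ball of radius `1` around `g` lies in the ball of radius `d(1, g)`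
around `1`. -/
def IsDeadEnd {G : Type*} [Group G] (X : Set G) (g : G) : Prop :=
  wordBall X g 1 ⊆ wordBall X 1 (wordDist X 1 g)

/-- The depth of `g`: the largest `l` such that the ball of radius `l` around `g` lies in the ball
of radius `d(1, g)` around `1` (the value is `⊤` if there is no largest `l`, which can only happen
in finite groups when `X` is a finite generating set). -/
noncomputable def deadEndDepth {G : Type*} [Group G] (X : Set G) (g : G) : ℕ∞ :=
  sSup {d : ℕ∞ | ∃ l : ℕ, d = l ∧ wordBall X g l ⊆ wordBall X 1 (wordDist X 1 g)}

/-- `φ` acts at the point `x` as the translation by `s l` along the ray `l` containing `x`. -/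
def TranslatesAt {n : ℕ} (s : Fin n → ℤ) (φ : Equiv.Perm (ℕ × Fin n)) (x : ℕ × Fin n) : Prop :=
  ((φ x).1 : ℤ) = x.1 + s x.2 ∧ (φ x).2 = x.2

/-- The Houghton group `H_n`: the permutations of the disjoint union of `n` rays that are
translations on each ray outside a finite set. -/
def Houghton (n : ℕ) : Subgroup (Equiv.Perm (ℕ × Fin n)) where
  carrier := {φ | ∃ s : Fin n → ℤ, {x | ¬ TranslatesAt s φ x}.Finite}
  one_mem' := ⟨0, by simp [TranslatesAt]⟩
  mul_mem' := by
    rintro φ ψ ⟨s, hs⟩ ⟨t, ht⟩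
    refine ⟨fun l => t l + s l,
      (ht.union (hs.preimage (ψ.injective.injOn))).subset fun x hx => ?_⟩
    by_contra hcon
    simp only [Set.mem_union, Set.mem_preimage, Set.mem_ofPred_eq, not_or, not_not] at hcon
    obtain ⟨⟨h1, h2⟩, h3, h4⟩ := hcon
    refine hx ⟨?_, ?_⟩
    · rw [Equiv.Perm.mul_apply, h3, h1, h2, add_assoc]
    · rw [Equiv.Perm.mul_apply, h4, h2]
  inv_mem' := by
    rintro φ ⟨s, hs⟩
    refine ⟨fun l => - s l, (hs.image φ).subset fun x hx => ?_⟩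
    refine ⟨φ⁻¹ x, fun h => hx ?_, φ.apply_symm_apply x⟩
    obtain ⟨h1, h2⟩ := h
    have h3 : φ (φ⁻¹ x) = x := φ.apply_symm_apply x
    rw [h3] at h1 h2
    refine ⟨?_, h2.symm⟩
    simp only [h1, h2]
    ring

/-- The shift as a permutation of the two rays: it moves the first ray (index `0`) one step inward,
its endpoint to the endpoint of the second ray (index `1`), and the second ray one step outward. -/
def shiftPerm : Equiv.Perm (ℕ × Fin 2) where
  toFun x := if x.2 = 0 then (if x.1 = 0 then (0, 1) else (x.1 - 1, 0)) else (x.1 + 1, 1)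
  invFun x := if x.2 = 1 then (if x.1 = 0 then (0, 0) else (x.1 - 1, 1)) else (x.1 + 1, 0)
  left_inv := by
    rintro ⟨k, l⟩
    fin_cases l <;> rcases k with _ | k <;> simp
  right_inv := by
    rintro ⟨k, l⟩
    fin_cases l <;> rcases k with _ | k <;> simp

/-- The shift `s` as an element of `H_2`. -/
def houghtonShift : Houghton 2 :=
  ⟨shiftPerm, ![-1, 1], (Set.finite_singleton ((0, 0) : ℕ × Fin 2)).subset fun x hx => by
    obtain ⟨k, l⟩ := x
    by_contra hne
    refine hx ?_
    fin_cases l <;> rcases k with _ | k <;> simp_all [TranslatesAt, shiftPerm]⟩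

/-- The transposition of the `j`-th points of the two rays, as an element of `H_2`. Numbering the
points of one ray `1, 2, 3, …` and those of the other `-1, -2, -3, …`, this is the transposition
`(-(j+1), j+1)`. -/
def houghtonSwap (j : ℕ) : Houghton 2 :=
  ⟨Equiv.swap (j, 0) (j, 1), 0,
    (Set.toFinite ({(j, 0), (j, 1)} : Set (ℕ × Fin 2))).subset fun x hx => by
      by_contra hne
      simp only [Set.mem_insert_iff, Set.mem_singleton_iff, not_or] at hne
      refine hx ?_
      simp [TranslatesAt, Equiv.swap_apply_of_ne_of_ne hne.1 hne.2]⟩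

/-- The generating set `X = {s, σ}` of `H_2`, where `σ = (-1, 1)`. -/
def houghtonGens : Set (Houghton 2) := {houghtonShift, houghtonSwap 0}

/-- The element `g_k = (-k, k) ⋯ (-2, 2)(-1, 1)` of `H_2`, with trivial shift. -/
def houghtonDeadEnd (k : ℕ) : Houghton 2 :=
  (((List.range k).reverse).map houghtonSwap).prod

/-!
Read `ℕ × Fin 2` as the integer line, the first ray being the negative integers and the second
the nonnegative ones. Right multiplication by the generators then describes a head moving along a
row of labels: a word is a walk of the head, which sits in the gap between the points `-1` and `0`
of the moving frame, `houghtonShift` moves it one gap to the right, and `houghtonSwap 0` exchanges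
the two labels adjacent to it. The element `houghtonDeadEnd k` has the head in its starting
position and the labels of the window `[-k, k)` in reversed order.

*Upper bound.* If only labels of `[-k, k)` are displaced and the head is at an end of the window,
one sweep over the window brings one extreme label home, the sweep back brings the other one home,
and one further step puts the head at an end of the window of half-width `k - 1`
(`Reach.sweep_right`, `Reach.sweep_left`). Hence any arrangement inside `[-k, k)` with head at `p`,
`|p| ≤ k - 1`, has length at most `4k² - k - 2 - |p|` (`reach_of_fixesOff`). Since this bound holds
for all arrangements at once, it holds on the ball of radius `k` about `houghtonDeadEnd k`
(`reach_mul_prod`); it also shows that the generators generate, because every element of `H_2` is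
an arrangement inside some window (`exists_fixesOff`).

*Lower bound.* A swap changes the order of one pair of labels only, so a word for
`houghtonDeadEnd k` contains at least `k (2k - 1)` swaps. A head move crosses exactly one label, and
for each label `e` the number of crossings to the right minus the number of crossings to the left
is the function `crossings` of the current arrangement. Think of a move as traversing an edge
`(e, l)` between the values `l` and `l + 1` of this number. For `houghtonDeadEnd k` the final values
force `2k(k - 1)` different edges to be traversed an odd number of times. Moreover, whenever
the head gets to distance `j` from the origin for the first time, `1 ≤ j ≤ k - 1`, it traverses an
edge outside that set; these `k - 1` edges are distinct, and each must be traversed at least twice.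
So there are at least `2k(k - 1) + 2(k - 1)` moves (`Ledger.card_ge`), and the two counts add up to
`4k² - k - 2`.
-/

open Equiv

/-! ### The action on the integer line -/

/-- The two rays as one line: the point `(j, 0)` is the integer `-j - 1` and `(j, 1)` is `j`. -/
def rayLine : ℕ × Fin 2 ≃ ℤ where
  toFun x := if x.2 = 0 then -(x.1 : ℤ) - 1 else x.1
  invFun y := if y < 0 then ((-y - 1).toNat, 0) else (y.toNat, 1)
  left_inv := by
    rintro ⟨j, l⟩
    fin_cases l
    · have h : -(j : ℤ) - 1 < 0 := by lia
      simp [h]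
    · simp
  right_inv := by
    intro y
    by_cases h : y < 0
    · simp [h]
    · simp [h]; lia

/-- The action of `H_2` on the line. The value `lineAction g x` is read as the label found at the
point `x` of the frame centred at the head, and `(lineAction g).symm e` as the place of the
label `e`. -/
def lineAction : Houghton 2 →* Perm ℤ :=
  rayLine.permCongrHom.toMonoidHom.comp (Houghton 2).subtype

lemma lineAction_apply (g : Houghton 2) (x : ℤ) :
    lineAction g x = rayLine (g.1 (rayLine.symm x)) := rfl

lemma lineAction_injective : Function.Injective lineAction :=
  rayLine.permCongrHom.injective.comp Subtype.val_injective

lemma lineAction_shift (x : ℤ) : lineAction houghtonShift x = x + 1 := by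
  simp only [lineAction_apply, houghtonShift, shiftPerm, rayLine, Equiv.coe_fn_mk,
    Equiv.coe_fn_symm_mk]
  by_cases h : x < 0
  · by_cases h' : x = -1
    · subst h'; simp
    · simp [h]; lia
  · simp [h]; lia

lemma lineAction_swap (j : ℕ) : lineAction (houghtonSwap j) = swap (-(j : ℤ) - 1) j := by
  ext x
  rw [lineAction_apply]
  change rayLine (swap (j, 0) (j, 1) (rayLine.symm x)) = _
  have h0 : rayLine (j, 0) = -(j : ℤ) - 1 := rfl
  have h1 : rayLine (j, 1) = j := rfl
  simp only [swap_apply_def, Equiv.symm_apply_eq, apply_ite rayLine, Equiv.apply_symm_apply, h0, h1]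

lemma lineAction_mul_shift (g : Houghton 2) (x : ℤ) :
    lineAction (g * houghtonShift) x = lineAction g (x + 1) := by
  rw [map_mul, Perm.mul_apply, lineAction_shift]

lemma lineAction_mul_shift_inv (g : Houghton 2) (x : ℤ) :
    lineAction (g * houghtonShift⁻¹) x = lineAction g (x - 1) := by
  have := lineAction_mul_shift (g * houghtonShift⁻¹) (x - 1)
  rw [inv_mul_cancel_right, sub_add_cancel] at this
  exact this.symm

lemma lineAction_mul_swap (g : Houghton 2) (x : ℤ) :
    lineAction (g * houghtonSwap 0) x = lineAction g (swap (-1) 0 x) := by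
  rw [map_mul, Perm.mul_apply, lineAction_swap]; simp

lemma lineAction_mul_shift_symm (g : Houghton 2) (e : ℤ) :
    (lineAction (g * houghtonShift)).symm e = (lineAction g).symm e - 1 := by
  rw [Equiv.symm_apply_eq, lineAction_mul_shift]; simp

lemma lineAction_mul_shift_inv_symm (g : Houghton 2) (e : ℤ) :
    (lineAction (g * houghtonShift⁻¹)).symm e = (lineAction g).symm e + 1 := by
  rw [Equiv.symm_apply_eq, lineAction_mul_shift_inv]; simp

lemma lineAction_mul_swap_symm (g : Houghton 2) (e : ℤ) :
    (lineAction (g * houghtonSwap 0)).symm e = swap (-1) 0 ((lineAction g).symm e) := by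
  rw [Equiv.symm_apply_eq, lineAction_mul_swap, Equiv.swap_apply_self]; simp

lemma lineAction_deadEnd (k : ℕ) (x : ℤ) :
    lineAction (houghtonDeadEnd k) x = if -(k : ℤ) ≤ x ∧ x < k then -1 - x else x := by
  induction k generalizing x with
  | zero =>
    simp [houghtonDeadEnd]
  | succ k ih =>
    have : houghtonDeadEnd (k + 1) = houghtonSwap k * houghtonDeadEnd k := by
      simp [houghtonDeadEnd, List.range_succ]
    rw [this, map_mul, Perm.mul_apply, ih, lineAction_swap, swap_apply_def]
    push_cast
    split_ifs <;> lia

/-! ### Arrangements inside a window -/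

/-- With the head displaced by `p`, all labels outside the window `[lo, hi)` are at their original
places. The head is in the gap between the points `p - 1` and `p` of the fixed frame, so that the
point `y` of the fixed frame is `y - p` in the frame of the head. -/
def FixesOff (lo hi p : ℤ) (g : Houghton 2) : Prop :=
  ∀ y : ℤ, y < lo ∨ hi ≤ y → lineAction g (y - p) = y

lemma FixesOff.mul_shift {lo hi p : ℤ} {g : Houghton 2} (h : FixesOff lo hi p g) :
    FixesOff lo hi (p + 1) (g * houghtonShift) := fun y hy => by
  rw [lineAction_mul_shift, sub_add_eq_sub_sub, sub_add_cancel, h y hy]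

lemma FixesOff.mul_shift_inv {lo hi p : ℤ} {g : Houghton 2} (h : FixesOff lo hi p g) :
    FixesOff lo hi (p - 1) (g * houghtonShift⁻¹) := fun y hy => by
  rw [lineAction_mul_shift_inv, show y - (p - 1) - 1 = y - p by ring, h y hy]

lemma FixesOff.mul_swap {lo hi p : ℤ} {g : Houghton 2} (h : FixesOff lo hi p g)
    (hlo : lo < p) (hhi : p < hi) : FixesOff lo hi p (g * houghtonSwap 0) := fun y hy => by
  rw [lineAction_mul_swap, Equiv.swap_apply_of_ne_of_ne (by lia) (by lia), h y hy]

lemma FixesOff.mono {lo hi lo' hi' p : ℤ} {g : Houghton 2} (h : FixesOff lo hi p g)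
    (hlo : lo' ≤ lo) (hhi : hi ≤ hi') : FixesOff lo' hi' p g :=
  fun y hy => h y (by lia)

/-- The labels of the window are at places in the window. -/
lemma FixesOff.symm_mem {lo hi p e : ℤ} {g : Houghton 2} (h : FixesOff lo hi p g)
    (hlo : lo ≤ e) (hhi : e < hi) :
    lo ≤ (lineAction g).symm e + p ∧ (lineAction g).symm e + p < hi := by
  by_contra hcon
  have := h ((lineAction g).symm e + p) (by lia)
  rw [add_sub_cancel_right, Equiv.apply_symm_apply] at this
  lia

/-- The places in the window carry labels of the window. -/
lemma FixesOff.apply_mem {lo hi p x : ℤ} {g : Houghton 2} (h : FixesOff lo hi p g)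
    (hlo : lo ≤ x + p) (hhi : x + p < hi) :
    lo ≤ lineAction g x ∧ lineAction g x < hi := by
  by_contra hcon
  have := (lineAction g).injective (h (lineAction g x) (by lia))
  lia

/-! ### Words -/

/-- The letters of the words in the definition of `wordLength houghtonGens`. -/
def IsLetter (x : Houghton 2) : Prop := x ∈ houghtonGens ∨ x⁻¹ ∈ houghtonGens

lemma isLetter_shift : IsLetter houghtonShift := Or.inl (Or.inl rfl)

lemma isLetter_shift_inv : IsLetter houghtonShift⁻¹ := Or.inr (Or.inl (inv_inv _))

lemma isLetter_swap : IsLetter (houghtonSwap 0) := Or.inl (Or.inr rfl)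

lemma swap_mul_self : houghtonSwap 0 * houghtonSwap 0 = 1 :=
  Subtype.ext (Equiv.swap_mul_self _ _)

lemma IsLetter.cases {x : Houghton 2} (hx : IsLetter x) :
    x = houghtonShift ∨ x = houghtonShift⁻¹ ∨ x = houghtonSwap 0 := by
  rcases hx with (h | h) | (h | h)
  · exact Or.inl h
  · exact Or.inr (Or.inr h)
  · exact Or.inr (Or.inl (inv_eq_iff_eq_inv.1 h))
  · exact Or.inr (Or.inr ((inv_eq_iff_eq_inv.1 h).trans (inv_eq_of_mul_eq_one_left swap_mul_self)))

/-- `g` is represented by a word of length at most `n`. -/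
def Reach (n : ℕ) (g : Houghton 2) : Prop :=
  ∃ w : List (Houghton 2), (∀ x ∈ w, IsLetter x) ∧ w.prod = g ∧ w.length ≤ n

lemma Reach.mono {m n : ℕ} {g : Houghton 2} (h : Reach m g) (hmn : m ≤ n) : Reach n g :=
  let ⟨w, h1, h2, h3⟩ := h
  ⟨w, h1, h2, h3.trans hmn⟩

lemma Reach.mul_letter {n : ℕ} {g x : Houghton 2} (h : Reach n g) (hx : IsLetter x) :
    Reach (n + 1) (g * x) := by
  obtain ⟨w, h1, rfl, h3⟩ := h
  refine ⟨w ++ [x], ?_, by simp, by simpa⟩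
  simp only [List.mem_append, List.mem_singleton]
  rintro y (hy | rfl)
  exacts [h1 y hy, hx]

lemma Reach.of_mul_shift {n : ℕ} {g : Houghton 2} (h : Reach n (g * houghtonShift)) :
    Reach (n + 1) g := by
  simpa using h.mul_letter isLetter_shift_inv

lemma Reach.of_mul_shift_inv {n : ℕ} {g : Houghton 2} (h : Reach n (g * houghtonShift⁻¹)) :
    Reach (n + 1) g := by
  simpa using h.mul_letter isLetter_shift

lemma Reach.of_mul_swap {n : ℕ} {g : Houghton 2} (h : Reach n (g * houghtonSwap 0)) :
    Reach (n + 1) g := by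
  simpa [mul_assoc, swap_mul_self] using h.mul_letter isLetter_swap

lemma Reach.wordLength_le {n : ℕ} {g : Houghton 2} (h : Reach n g) :
    wordLength houghtonGens g ≤ n :=
  let ⟨w, h1, h2, h3⟩ := h
  le_trans (Nat.sInf_le ⟨w, h1, h2, rfl⟩) h3

/-! ### Sorting by sweeps -/

/-- The head sweeps from `p` to the right end of the window, taking along the largest label `hi - 1`
from wherever it meets it. This costs `n` moves and at most `n + 1` swaps, after which the window
has shrunk by one place. The hypothesis `hb` says that this label is not where the sweep would
miss it. -/
lemma Reach.sweep_right {lo hi p : ℤ} {m n : ℕ} {g : Houghton 2}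
    (hg : FixesOff lo hi p g) (hp : lo < p) (hn : p + n = hi - 1)
    (hb : ∀ x ≤ -2, lineAction g x ≠ hi - 1)
    (H : ∀ h, FixesOff lo (hi - 1) (hi - 1) h → Reach m h) : Reach (m + 2 * n + 1) g := by
  -- Swap first if the label `hi - 1` is directly left of the head.
  obtain ⟨g₁, hg₁, hb₁, hr⟩ : ∃ g₁, FixesOff lo hi p g₁ ∧ (∀ x ≤ -1, lineAction g₁ x ≠ hi - 1) ∧
      ∀ l, Reach l g₁ → Reach (l + 1) g := by
    by_cases hc : lineAction g (-1) = hi - 1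
    · refine ⟨g * houghtonSwap 0, hg.mul_swap hp (by lia), fun x hx => ?_, fun l => .of_mul_swap⟩
      rw [lineAction_mul_swap]
      rcases hx.lt_or_eq with hx | rfl
      · rw [swap_apply_of_ne_of_ne (by lia) (by lia)]
        exact hb x (by lia)
      · rw [swap_apply_left, ← hc]
        exact (lineAction g).injective.ne (by lia)
    · refine ⟨g, hg, fun x hx => ?_, fun l h => h.mono l.le_succ⟩
      rcases hx.lt_or_eq with hx | rfl
      exacts [hb x (by lia), hc]
  rcases n with _ | n
  · refine hr _ (H _ fun y hy => ?_)
    obtain rfl : p = hi - 1 := by lia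
    have hs := hg₁.symm_mem (e := hi - 1) (by lia) (by lia)
    have hs' : ¬ (lineAction g₁).symm (hi - 1) ≤ -1 := fun h =>
      hb₁ _ h (Equiv.apply_symm_apply _ _)
    rcases hy with hy | hy
    · exact hg₁ y (Or.inl hy)
    rcases hy.lt_or_eq with hy | rfl
    · exact hg₁ y (by lia)
    · rw [sub_self, ← show (lineAction g₁).symm (hi - 1) = 0 by lia, Equiv.apply_symm_apply]
  · have := sweep_right hg₁.mul_shift (by lia) (n := n) (by lia)
      (fun x hx => by rw [lineAction_mul_shift]; exact hb₁ _ (by lia)) H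
    exact hr _ this.of_mul_shift
termination_by n

/-- The mirror image of `Reach.sweep_right`: the smallest label `lo` is brought to the left end. -/
lemma Reach.sweep_left {lo hi p : ℤ} {m n : ℕ} {g : Houghton 2}
    (hg : FixesOff lo hi p g) (hp : p < hi) (hn : p - n = lo + 1)
    (ha : ∀ x ≥ 1, lineAction g x ≠ lo)
    (H : ∀ h, FixesOff (lo + 1) hi (lo + 1) h → Reach m h) : Reach (m + 2 * n + 1) g := by
  -- Swap first if the label `lo` is directly right of the head.
  obtain ⟨g₁, hg₁, ha₁, hr⟩ : ∃ g₁, FixesOff lo hi p g₁ ∧ (∀ x ≥ 0, lineAction g₁ x ≠ lo) ∧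
      ∀ l, Reach l g₁ → Reach (l + 1) g := by
    by_cases hc : lineAction g 0 = lo
    · refine ⟨g * houghtonSwap 0, hg.mul_swap (by lia) hp, fun x hx => ?_, fun l => .of_mul_swap⟩
      rw [lineAction_mul_swap]
      rcases hx.lt_or_eq with hx | rfl
      · rw [swap_apply_of_ne_of_ne (by lia) (by lia)]
        exact ha x (by lia)
      · rw [swap_apply_right, ← hc]
        exact (lineAction g).injective.ne (by lia)
    · refine ⟨g, hg, fun x hx => ?_, fun l h => h.mono l.le_succ⟩
      rcases hx.lt_or_eq with hx | rfl
      exacts [ha x (by lia), hc]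
  rcases n with _ | n
  · refine hr _ (H _ fun y hy => ?_)
    obtain rfl : p = lo + 1 := by lia
    have hs := hg₁.symm_mem (e := lo) (by lia) (by lia)
    have hs' : ¬ 0 ≤ (lineAction g₁).symm lo := fun h =>
      ha₁ _ h (Equiv.apply_symm_apply _ _)
    rcases hy with hy | hy
    · rcases (Int.lt_add_one_iff.1 hy).lt_or_eq with hy | rfl
      · exact hg₁ y (Or.inl hy)
      · rw [show y - (y + 1) = (lineAction g₁).symm y by lia, Equiv.apply_symm_apply]
    · exact hg₁ y (Or.inr hy)
  · have := sweep_left hg₁.mul_shift_inv (by lia) (n := n) (by lia)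
      (fun x hx => by rw [lineAction_mul_shift_inv]; exact ha₁ _ (by lia)) H
    exact hr _ this.of_mul_shift_inv
termination_by n

lemma FixesOff.eq_one {a : ℤ} {g : Houghton 2} (h : FixesOff a (a + 1) 0 g) : g = 1 := by
  apply lineAction_injective
  ext y
  rw [map_one, Perm.one_apply]
  have := h.apply_mem (x := a)
  rcases eq_or_ne y a with rfl | hy
  · lia
  · simpa using h y (by lia)

/-- The two sweeps applied repeatedly, from either end of the window `[-(k + 1), k + 1)`. Passing
from the window for `k + 1` to the window for `k` takes `4k + 5` moves and at most `4k + 5`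
swaps. -/
lemma reach_of_head_at_end (k : ℕ) {g : Houghton 2} :
    (FixesOff (-(k + 1 : ℕ)) (k + 1 : ℕ) (-k) g → Reach (4 * k ^ 2 + 6 * k + 1) g) ∧
      (FixesOff (-(k + 1 : ℕ)) (k + 1 : ℕ) k g → Reach (4 * k ^ 2 + 6 * k + 1) g) := by
  induction k generalizing g with
  | zero =>
    have base : FixesOff (-1) 1 0 g → Reach 1 g := fun hg =>
      Reach.sweep_left (m := 0) (n := 0) hg (by lia) (by lia)
        (fun x hx => by
          have := hg x (by lia)
          simp only [sub_zero] at this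
          lia)
        (fun h hh => ⟨[], by simp, hh.eq_one.symm, le_rfl⟩)
    exact ⟨by simpa using base, by simpa using base⟩
  | succ k ih =>
    constructor <;> intro hg
    · refine (Reach.sweep_right hg (n := 2 * (k + 1))
        (m := 4 * k ^ 2 + 6 * k + 1 + 1 + 2 * (2 * k + 1) + 1 + 1) (by lia) (by lia) ?_ ?_).mono
        (by lia)
      · intro x hx
        have := hg (x - (k + 1 : ℕ)) (by lia)
        rw [sub_neg_eq_add, sub_add_cancel] at this
        lia
      intro h hh
      -- The label `k + 1` is home; one step back brings the head to the end of the smaller window.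
      refine Reach.of_mul_shift_inv ?_
      refine Reach.sweep_left hh.mul_shift_inv (by lia) (n := 2 * k + 1) (by lia) ?_ ?_
      · intro x hx
        have := hh (x - 1 + ((k + 1 + 1 : ℕ) - 1)) (by lia)
        rw [add_sub_cancel_right] at this
        rw [lineAction_mul_shift_inv]
        lia
      intro h hh
      refine Reach.of_mul_shift (ih.1 ?_)
      convert hh.mul_shift using 1 <;> lia
    · refine (Reach.sweep_left hg (n := 2 * (k + 1))
        (m := 4 * k ^ 2 + 6 * k + 1 + 1 + 2 * (2 * k + 1) + 1 + 1) (by lia) (by lia) ?_ ?_).mono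
        (by lia)
      · intro x hx
        have := hg (x + (k + 1 : ℕ)) (by lia)
        rw [add_sub_cancel_right] at this
        lia
      intro h hh
      refine Reach.of_mul_shift ?_
      refine Reach.sweep_right hh.mul_shift (by lia) (n := 2 * k + 1) (by lia) ?_ ?_
      · intro x hx
        have := hh (x + 1 + (-(k + 1 + 1 : ℕ) + 1)) (by lia)
        rw [add_sub_cancel_right] at this
        rw [lineAction_mul_shift]
        lia
      intro h hh
      refine Reach.of_mul_shift_inv (ih.2 ?_)
      convert hh.mul_shift_inv using 1 <;> lia

/-- An arrangement inside the window `[-(k + 1), k + 1)` is sorted by first walking to the end of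
the window nearer to the head. -/
lemma reach_of_fixesOff {k : ℕ} {p : ℤ} {g : Houghton 2}
    (hg : FixesOff (-(k + 1 : ℕ)) (k + 1 : ℕ) p g) (hp : p.natAbs ≤ k) :
    Reach (4 * k ^ 2 + 7 * k + 1 - p.natAbs) g := by
  obtain ⟨d, hd⟩ : ∃ d : ℕ, p.natAbs + d = k := ⟨_, Nat.add_sub_cancel' hp⟩
  suffices H : Reach (4 * k ^ 2 + 6 * k + 1 + d) g from H.mono (by lia)
  clear hp
  induction d generalizing p g with
  | zero =>
    rcases le_total p 0 with h | h
    · obtain rfl : p = -k := by lia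
      exact (reach_of_head_at_end k).1 hg
    · obtain rfl : p = k := by lia
      exact (reach_of_head_at_end k).2 hg
  | succ d ih =>
    rcases le_total p 0 with h | h
    · exact (ih hg.mul_shift_inv (by lia)).of_mul_shift_inv
    · exact (ih hg.mul_shift (by lia)).of_mul_shift

/-! ### Generation -/

/-- A permutation of `ℤ` that is a translation near `+∞` and near `-∞` is the same translation at
both ends: compare the sizes of a large interval and its image. -/
lemma shift_eq_of_eventually {f : Perm ℤ} {N : ℕ} {a b : ℤ}
    (ha : ∀ x : ℤ, N ≤ x → f x = x + a) (hb : ∀ x : ℤ, x < -N → f x = x + b) : a = b := by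
  set M : ℤ := N + a.natAbs + b.natAbs
  have himg : (Finset.Ico (-M) M).map f.toEmbedding = Finset.Ico (-M + b) (M + a) := by
    ext y
    simp only [Finset.mem_map_equiv, Finset.mem_Ico]
    have key : f (f.symm y) = y := f.apply_symm_apply y
    have h1 := ha (f.symm y)
    have h2 := hb (f.symm y)
    constructor
    · intro h
      by_contra hc
      rcases not_and_or.1 hc with hc | hc
      · have h3 := hb (y - b) (by lia)
        rw [sub_add_cancel, ← key] at h3
        have := f.injective h3
        rw [key] at this
        lia
      · have h3 := ha (y - a) (by lia)
        rw [sub_add_cancel, ← key] at h3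
        have := f.injective h3
        rw [key] at this
        lia
    · intro h
      lia
  have hcard := congrArg Finset.card himg
  rw [Finset.card_map, Int.card_Ico, Int.card_Ico] at hcard
  lia

/-- Every element of `H_2` is an arrangement inside some window, with the head inside it. -/
lemma exists_fixesOff (g : Houghton 2) :
    ∃ (k : ℕ) (p : ℤ), p.natAbs ≤ k ∧ FixesOff (-(k + 1 : ℕ)) (k + 1 : ℕ) p g := by
  obtain ⟨s, hs⟩ := g.2
  obtain ⟨N, hN⟩ : ∃ N : ℕ, ∀ x, ¬ TranslatesAt s g.1 x → x.1 < N := by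
    obtain ⟨N, hN⟩ := (hs.image Prod.fst).bddAbove
    exact ⟨N + 1, fun x hx => Nat.lt_succ_of_le (hN ⟨x, hx, rfl⟩)⟩
  have hT : ∀ x, N ≤ x.1 → TranslatesAt s g.1 x := fun x hx => by
    by_contra h
    exact (hN x h).not_ge hx
  have h0 : ∀ x : ℤ, x < -N → lineAction g x = x + -s 0 := fun x hx => by
    obtain ⟨⟨j, l⟩, rfl⟩ := rayLine.surjective x
    obtain rfl : l = 0 := by
      by_contra hl
      simp [rayLine, hl] at hx
      lia
    have hx' : -(j : ℤ) - 1 < -N := hx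
    obtain ⟨h1, h2⟩ := hT (j, 0) (by simp only; lia)
    rw [lineAction_apply, Equiv.symm_apply_apply]
    simp only [rayLine, Equiv.coe_fn_mk, h1, h2, if_true]
    ring
  have h1 : ∀ x : ℤ, N ≤ x → lineAction g x = x + s 1 := fun x hx => by
    obtain ⟨⟨j, l⟩, rfl⟩ := rayLine.surjective x
    obtain rfl : l = 1 := by
      by_contra hl
      obtain rfl : l = 0 := by lia
      simp [rayLine] at hx
      lia
    have hx' : (N : ℤ) ≤ j := hx
    obtain ⟨h1, h2⟩ := hT (j, 1) (by simp only; lia)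
    rw [lineAction_apply, Equiv.symm_apply_apply]
    simp only [rayLine, Equiv.coe_fn_mk, h1, h2]
    simp
  have hflux := shift_eq_of_eventually h1 h0
  refine ⟨N + (s 1).natAbs, s 1, by lia, fun y hy => ?_⟩
  rcases hy with hy | hy
  · rw [h0 _ (by lia)]; lia
  · rw [h1 _ (by lia)]; lia

lemma exists_reach (g : Houghton 2) : ∃ n, Reach n g :=
  let ⟨_, _, hp, hg⟩ := exists_fixesOff g
  ⟨_, reach_of_fixesOff hg hp⟩

lemma closure_houghtonGens : Subgroup.closure houghtonGens = ⊤ := by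
  refine (Subgroup.eq_top_iff' _).2 fun g => ?_
  obtain ⟨_, w, hw, rfl, -⟩ := exists_reach g
  refine Subgroup.list_prod_mem _ fun x hx => ?_
  rcases hw x hx with h | h
  · exact Subgroup.subset_closure h
  · exact (Subgroup.inv_mem_iff _).1 (Subgroup.subset_closure h)

lemma exists_word (g : Houghton 2) :
    ∃ w : List (Houghton 2), (∀ x ∈ w, IsLetter x) ∧ w.prod = g ∧
      w.length = wordLength houghtonGens g := by
  obtain ⟨_, w, hw, hg, -⟩ := exists_reach g
  exact Nat.sInf_mem (s := {n | ∃ w : List (Houghton 2),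
    (∀ x ∈ w, x ∈ houghtonGens ∨ x⁻¹ ∈ houghtonGens) ∧ w.prod = g ∧ w.length = n})
    ⟨_, w, hw, hg, rfl⟩

/-! ### The ball about an arrangement inside a window -/

lemma FixesOff.mul_letter {k : ℕ} {p : ℤ} {g x : Houghton 2}
    (hg : FixesOff (-(k + 1 : ℕ)) (k + 1 : ℕ) p g) (hp : p.natAbs ≤ k) (hx : IsLetter x) :
    ∃ q : ℤ, q.natAbs ≤ p.natAbs + 1 ∧ FixesOff (-(k + 1 : ℕ)) (k + 1 : ℕ) q (g * x) := by
  rcases hx.cases with rfl | rfl | rfl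
  · exact ⟨p + 1, by lia, hg.mul_shift⟩
  · exact ⟨p - 1, by lia, hg.mul_shift_inv⟩
  · exact ⟨p, by lia, hg.mul_swap (by lia) (by lia)⟩

lemma FixesOff.mul_prod {k : ℕ} {g : Houghton 2}
    (hg : FixesOff (-(k + 1 : ℕ)) (k + 1 : ℕ) 0 g) (w : List (Houghton 2))
    (hw : ∀ x ∈ w, IsLetter x) (hk : w.length ≤ k) :
    ∃ p : ℤ, p.natAbs ≤ w.length ∧ FixesOff (-(k + 1 : ℕ)) (k + 1 : ℕ) p (g * w.prod) := by
  induction w using List.reverseRecOn with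
  | nil => exact ⟨0, by simp, by simpa using hg⟩
  | append_singleton w x ih =>
    simp only [List.length_append, List.length_singleton] at hk
    obtain ⟨p, hp, h⟩ := ih (fun y hy => hw y (by simp [hy])) (by lia)
    obtain ⟨q, hq, h'⟩ := h.mul_letter (by lia) (hw x (by simp))
    exact ⟨q, by simp; lia, by simpa [mul_assoc] using h'⟩

/-- The length bound on the ball of radius `k + 1`. A word of at most `k` letters keeps the head
inside the window. If the head is off the origin before the last letter, the length is below the
bound by at least one at that point; if it is at the origin, it is still inside the window
afterwards, since `1 ≤ k`. -/
lemma reach_mul_prod {k : ℕ} (hk : 1 ≤ k) {g : Houghton 2}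
    (hg : FixesOff (-(k + 1 : ℕ)) (k + 1 : ℕ) 0 g) (w : List (Houghton 2))
    (hw : ∀ x ∈ w, IsLetter x) (hwk : w.length ≤ k + 1) :
    Reach (4 * k ^ 2 + 7 * k + 1) (g * w.prod) := by
  rcases w.eq_nil_or_concat' with rfl | ⟨w, x, rfl⟩
  · simpa using reach_of_fixesOff hg (by simp)
  simp only [List.length_append, List.length_singleton, Nat.add_le_add_iff_right] at hwk
  obtain ⟨p, hp, h⟩ := hg.mul_prod w (fun y hy => hw y (by simp [hy])) hwk
  have hx : IsLetter x := hw x (by simp)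
  rw [List.prod_append, List.prod_singleton, ← mul_assoc]
  rcases eq_or_ne p 0 with rfl | hp0
  · obtain ⟨q, hq, h'⟩ := h.mul_letter (by simp) hx
    exact (reach_of_fixesOff h' (by simp at hq; lia)).mono (Nat.sub_le _ _)
  · exact ((reach_of_fixesOff h (by lia)).mul_letter hx).mono (by lia)

/-! ### Crossings, inversions and the ledger of a word -/

/-- The integers with the points `-1` and `0` identified. The swap does not change the collapsed
place of a label, and neither does a move of the head across it; a move of the head across another
label changes it by one, in the direction opposite to the move. -/
def collapse (x : ℤ) : ℤ := if x < 0 then x + 1 else x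

/-- The net number of rightward crossings of the label `e` by the head, as a function of the
arrangement `g` and the displacement `p` of the head: among the letters, only the moves across `e`
change the sum of the displacement and the collapsed place of `e`. -/
def crossings (g : Houghton 2) (p e : ℤ) : ℤ :=
  collapse ((lineAction g).symm e) + p - collapse e

/-- The edge from `l` to `l + 1` lies on the segment between `0` and `c`. -/
def Between (c l : ℤ) : Prop := 0 ≤ l ∧ l < c ∨ c ≤ l ∧ l < 0

/-- The ordered pairs of distinct labels of `[-K, K)` whose order is reversed; every inversion is
counted twice. -/
noncomputable def discordant (K : ℕ) (g : Houghton 2) : Finset (ℤ × ℤ) :=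
  (Finset.Ico (-K : ℤ) K).offDiag.filter fun x =>
    ¬(x.1 < x.2 ↔ (lineAction g).symm x.1 < (lineAction g).symm x.2)

/-- The record of a word for `g`: the head has displacement `p`, has never been further than `J`
from the origin, and its moves have traversed the edges in `E`, counted with multiplicity. An edge
`(e, l)` is traversed when the net number of crossings of `e` passes between `l` and `l + 1`. The
last field lists the edge traversed when the head first gets to distance `j`: a crossing of a label
`e` of the window `[-j, j)`, to the right at the right end or to the left at the left end. -/
structure Ledger (g : Houghton 2) (p : ℤ) (J : ℕ) (E : Multiset (ℤ × ℤ)) : Prop where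
  natAbs_le : p.natAbs ≤ J
  fixesOff : FixesOff (-(J + 1 : ℕ)) (J + 1 : ℕ) p g
  odd_count : ∀ e l : ℤ, Odd (E.count (e, l)) ↔ Between (crossings g p e) l
  first_visit : ∀ j : ℕ, 1 ≤ j → j ≤ J → ∃ e : ℤ, -j ≤ e ∧ e < j ∧
    ((e, j - 1 - collapse e) ∈ E ∨ (e, -j - collapse e) ∈ E)

lemma ledger_one : Ledger 1 0 0 0 where
  natAbs_le := le_rfl
  fixesOff y _ := by simp
  odd_count e l := by
    have : crossings 1 0 e = 0 := by simp [crossings, ← Perm.inv_def]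
    simp [this, Between]
  first_visit j h1 h2 := by lia

lemma Ledger.mul_swap {g : Houghton 2} {p : ℤ} {J : ℕ} {E : Multiset (ℤ × ℤ)}
    (h : Ledger g p J E) : Ledger (g * houghtonSwap 0) p J E where
  natAbs_le := h.natAbs_le
  fixesOff := h.fixesOff.mul_swap (by have := h.natAbs_le; lia) (by have := h.natAbs_le; lia)
  odd_count e l := by
    rw [h.odd_count, crossings, crossings, lineAction_mul_swap_symm]
    have : ∀ x, collapse (swap (-1) 0 x) = collapse x := fun x => by
      simp only [collapse, swap_apply_def]
      split_ifs <;> lia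
    rw [this]
  first_visit := h.first_visit

lemma odd_count_cons {E : Multiset (ℤ × ℤ)} {e l e' l' : ℤ} :
    Odd (((e', l') ::ₘ E).count (e, l)) ↔
      if e = e' ∧ l = l' then ¬ Odd (E.count (e, l)) else Odd (E.count (e, l)) := by
  rw [Multiset.count_cons]
  by_cases h : e = e' ∧ l = l'
  · simp [h, Nat.odd_add_one]
  · simp [h]

lemma Ledger.mul_shift {g : Houghton 2} {p : ℤ} {J : ℕ} {E : Multiset (ℤ × ℤ)}
    (h : Ledger g p J E) : ∃ J' x, Ledger (g * houghtonShift) (p + 1) J' (x ::ₘ E) := by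
  set a := lineAction g 0 with ha
  have hp := h.natAbs_le
  refine ⟨max J (p + 1).natAbs, (a, p - collapse a), le_max_right _ _,
    h.fixesOff.mul_shift.mono (by lia) (by lia), fun e l => ?_, fun j h1 h2 => ?_⟩
  · rw [odd_count_cons, h.odd_count]
    simp only [crossings, lineAction_mul_shift_symm, Between]
    by_cases hea : e = a
    · have : (lineAction g).symm e = 0 := by rw [hea, ha, Equiv.symm_apply_apply]
      rw [this, hea]
      simp only [collapse]
      split_ifs <;> lia
    · have : (lineAction g).symm e ≠ 0 := fun h0 => hea (by rw [ha, ← h0, Equiv.apply_symm_apply])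
      simp only [collapse]
      split_ifs <;> lia
  · by_cases hj : j ≤ J
    · obtain ⟨e, he1, he2, he⟩ := h.first_visit j h1 hj
      exact ⟨e, he1, he2, he.imp (Multiset.mem_cons_of_mem) (Multiset.mem_cons_of_mem)⟩
    -- Only `j = J + 1` is new, and then the head has just left the previous range.
    · have hm := h.fixesOff.apply_mem (x := 0) (by lia) (by lia)
      refine ⟨a, by lia, by lia, Or.inl ?_⟩
      rw [show (j : ℤ) - 1 = p by lia]
      exact Multiset.mem_cons_self _ _

lemma Ledger.mul_shift_inv {g : Houghton 2} {p : ℤ} {J : ℕ} {E : Multiset (ℤ × ℤ)}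
    (h : Ledger g p J E) : ∃ J' x, Ledger (g * houghtonShift⁻¹) (p - 1) J' (x ::ₘ E) := by
  set a := lineAction g (-1) with ha
  have hp := h.natAbs_le
  refine ⟨max J (p - 1).natAbs, (a, p - 1 - collapse a), le_max_right _ _,
    h.fixesOff.mul_shift_inv.mono (by lia) (by lia), fun e l => ?_, fun j h1 h2 => ?_⟩
  · rw [odd_count_cons, h.odd_count]
    simp only [crossings, lineAction_mul_shift_inv_symm, Between]
    by_cases hea : e = a
    · have : (lineAction g).symm e = -1 := by rw [hea, ha, Equiv.symm_apply_apply]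
      rw [this, hea]
      simp only [collapse]
      split_ifs <;> lia
    · have : (lineAction g).symm e ≠ -1 :=
        fun h0 => hea (by rw [ha, ← h0, Equiv.apply_symm_apply])
      simp only [collapse]
      split_ifs <;> lia
  · by_cases hj : j ≤ J
    · obtain ⟨e, he1, he2, he⟩ := h.first_visit j h1 hj
      exact ⟨e, he1, he2, he.imp (Multiset.mem_cons_of_mem) (Multiset.mem_cons_of_mem)⟩
    · have hm := h.fixesOff.apply_mem (x := -1) (by lia) (by lia)
      refine ⟨a, by lia, by lia, Or.inr ?_⟩
      rw [show -(j : ℤ) = p - 1 by lia]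
      exact Multiset.mem_cons_self _ _

lemma discordant_mul_shift (K : ℕ) (g : Houghton 2) :
    discordant K (g * houghtonShift) = discordant K g := by
  simp only [discordant, lineAction_mul_shift_symm, sub_lt_sub_iff_right]

lemma discordant_mul_shift_inv (K : ℕ) (g : Houghton 2) :
    discordant K (g * houghtonShift⁻¹) = discordant K g := by
  simp only [discordant, lineAction_mul_shift_inv_symm, add_lt_add_iff_right]

lemma card_discordant_mul_swap (K : ℕ) (g : Houghton 2) :
    (discordant K (g * houghtonSwap 0)).card ≤ (discordant K g).card + 2 := by
  set a := lineAction g (-1) with ha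
  set b := lineAction g 0 with hb
  have hsub : discordant K (g * houghtonSwap 0) ⊆ discordant K g ∪ {(a, b), (b, a)} := by
    rintro ⟨e, f⟩ h
    simp only [discordant, Finset.mem_filter, Finset.mem_union, Finset.mem_insert,
      Finset.mem_singleton, Prod.mk.injEq, ha, hb, ← Equiv.symm_apply_eq,
      lineAction_mul_swap_symm] at h ⊢
    refine or_iff_not_imp_right.2 fun hne => ⟨h.1, fun hg => h.2 (hg.trans ?_)⟩
    have hef : (lineAction g).symm e ≠ (lineAction g).symm f :=
      (lineAction g).symm.injective.ne (Finset.mem_offDiag.1 h.1).2.2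
    simp only [swap_apply_def]
    split_ifs <;> lia
  exact (Finset.card_le_card hsub).trans ((Finset.card_union_le _ _).trans
    (Nat.add_le_add_left Finset.card_le_two _))

/-- Every move is entered in the ledger, and every swap creates at most one inversion. -/
lemma exists_ledger (K : ℕ) (w : List (Houghton 2)) (hw : ∀ x ∈ w, IsLetter x) :
    ∃ p J E, Ledger w.prod p J E ∧ 2 * E.card + (discordant K w.prod).card ≤ 2 * w.length := by
  induction w using List.reverseRecOn with
  | nil =>
    refine ⟨0, 0, 0, ledger_one, ?_⟩
    simp [discordant, ← Perm.inv_def]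
  | append_singleton w x ih =>
    obtain ⟨p, J, E, hL, hE⟩ := ih fun y hy => hw y (by simp [hy])
    rw [List.prod_append, List.prod_singleton, List.length_append, List.length_singleton]
    rcases (hw x (by simp)).cases with rfl | rfl | rfl
    · obtain ⟨J', x, h⟩ := hL.mul_shift
      refine ⟨_, _, _, h, ?_⟩
      rw [discordant_mul_shift, Multiset.card_cons]
      lia
    · obtain ⟨J', x, h⟩ := hL.mul_shift_inv
      refine ⟨_, _, _, h, ?_⟩
      rw [discordant_mul_shift_inv, Multiset.card_cons]
      lia
    · refine ⟨_, _, _, hL.mul_swap, ?_⟩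
      have := card_discordant_mul_swap K w.prod
      lia

/-! ### The lower bound for the reversal of a window -/

lemma deadEnd_symm (k : ℕ) (x : ℤ) : (lineAction (houghtonDeadEnd k)).symm x =
    if -(k : ℤ) ≤ x ∧ x < k then -1 - x else x := by
  rw [Equiv.symm_apply_eq, lineAction_deadEnd]
  split_ifs <;> lia

lemma card_discordant_deadEnd (k : ℕ) :
    (discordant k (houghtonDeadEnd k)).card = 2 * k * (2 * k) - 2 * k := by
  rw [discordant, Finset.filter_true_of_mem, Finset.offDiag_card, Int.card_Ico]
  · congr 1 <;> [congr 1; skip] <;> lia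
  · rintro ⟨e, f⟩ h
    simp only [Finset.mem_offDiag, Finset.mem_Ico] at h
    simp only [deadEnd_symm]
    split_ifs <;> lia

/-- The elements of a set `X` that occur an even nonzero number of times occur at least twice. -/
lemma card_add_two_mul_card_le {α : Type*} [DecidableEq α] {E : Multiset α} {C X : Finset α}
    (hC : ∀ x ∈ C, Odd (E.count x)) (hX : ∀ x ∈ X, x ∈ E ∧ ¬ Odd (E.count x)) :
    C.card + 2 * X.card ≤ E.card := by
  have hd : Disjoint C X := Finset.disjoint_left.2 fun x h1 h2 => (hX x h2).2 (hC x h1)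
  have hsub : C ∪ X ⊆ E.toFinset := by
    intro x hx
    rw [Multiset.mem_toFinset]
    rcases Finset.mem_union.1 hx with h | h
    exacts [Multiset.count_pos.1 (hC x h).pos, (hX x h).1]
  calc C.card + 2 * X.card = ∑ _x ∈ C, 1 + ∑ _x ∈ X, 2 := by simp [mul_comm]
    _ ≤ ∑ x ∈ C, E.count x + ∑ x ∈ X, E.count x := by
      refine add_le_add (Finset.sum_le_sum fun x hx => (hC x hx).pos)
        (Finset.sum_le_sum fun x hx => ?_)
      have h1 := Multiset.count_pos.2 (hX x hx).1
      have h2 := Nat.not_odd_iff_even.1 (hX x hx).2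
      obtain ⟨r, hr⟩ := h2
      lia
    _ = ∑ x ∈ C ∪ X, E.count x := (Finset.sum_union hd).symm
    _ ≤ ∑ x ∈ E.toFinset, E.count x := Finset.sum_le_sum_of_subset hsub
    _ = E.card := Multiset.toFinset_sum_count_eq E

lemma crossings_deadEnd {k : ℕ} {e : ℤ} (h1 : -k ≤ e) (h2 : e < k) :
    crossings (houghtonDeadEnd k) 0 e = -2 * collapse e := by
  rw [crossings, deadEnd_symm, if_pos ⟨h1, h2⟩]
  simp only [collapse]
  split_ifs <;> lia

lemma Between.iff_mem {c l : ℤ} : Between c l ↔ l ∈ Finset.Ico (min 0 c) (max 0 c) := by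
  simp only [Between, Finset.mem_Ico]; lia

/-- The edges that every word for `houghtonDeadEnd k` traverses an odd number of times. -/
noncomputable def deadEndEdges (k : ℕ) : Finset (ℤ × ℤ) :=
  (Finset.Ico (-k : ℤ) k).biUnion fun e =>
    (Finset.Ico (min 0 (-2 * collapse e)) (max 0 (-2 * collapse e))).map
      ⟨Prod.mk e, Prod.mk_right_injective e⟩

lemma card_deadEndEdges (k : ℕ) : (deadEndEdges (k + 1)).card = 2 * k * (k + 1) := by
  rw [deadEndEdges, Finset.card_biUnion]
  · simp only [Finset.card_map, Int.card_Ico]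
    induction k with
    | zero => decide
    | succ k ih =>
      have : Finset.Ico (-(k + 1 + 1 : ℕ) : ℤ) (k + 1 + 1 : ℕ) =
          insert (-(k + 1 + 1 : ℕ) : ℤ) (insert ((k + 1 : ℕ) : ℤ)
            (Finset.Ico (-(k + 1 : ℕ) : ℤ) (k + 1 : ℕ))) := by
        ext x; simp only [Finset.mem_insert, Finset.mem_Ico]; lia
      rw [this, Finset.sum_insert (by simp; lia), Finset.sum_insert (by simp), ih]
      simp only [collapse]
      rw [if_pos (by lia), if_neg (by lia)]
      lia
  · intro e _ f _ hef
    simp only [Finset.disjoint_left, Finset.mem_map, Function.Embedding.coeFn_mk]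
    rintro _ ⟨_, -, rfl⟩ ⟨_, -, h⟩
    exact hef (Prod.ext_iff.1 h).1.symm

/-- The lower bound for the number of head moves in a word for `houghtonDeadEnd (k + 1)`. -/
lemma Ledger.card_ge {k : ℕ} {p : ℤ} {J : ℕ} {E : Multiset (ℤ × ℤ)}
    (h : Ledger (houghtonDeadEnd (k + 1)) p J E) : 2 * k * (k + 1) + 2 * k ≤ E.card := by
  have hfix : ∀ y, _ := h.fixesOff
  -- Far out, the reversal fixes the labels, so the head is back at the origin.
  obtain rfl : p = 0 := by
    have := hfix (J + k + 2 + p.natAbs) (by lia)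
    rw [lineAction_deadEnd] at this
    split_ifs at this <;> lia
  -- The label `-k - 1` at the place `k` shows that the head has been at distance `k`.
  have hkJ : k ≤ J := by
    by_contra hc
    have := hfix k (by lia)
    rw [lineAction_deadEnd] at this
    split_ifs at this <;> lia
  have hv : ∀ j : Fin k, ∃ x : ℤ × ℤ, x ∈ E ∧ -(j + 1 : ℕ) ≤ x.1 ∧ x.1 < (j + 1 : ℕ) ∧
      (x.2 = (j + 1 : ℕ) - 1 - collapse x.1 ∨ x.2 = -(j + 1 : ℕ) - collapse x.1) := fun j => by
    obtain ⟨e, h1, h2, h3 | h3⟩ := h.first_visit (j + 1) (by lia) (by lia)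
    exacts [⟨_, h3, h1, h2, Or.inl rfl⟩, ⟨_, h3, h1, h2, Or.inr rfl⟩]
  choose x hxE hx1 hx2 hx3 using hv
  -- The sign of `l` tells the direction of the crossing, and `e`, `l` and the direction give `j`.
  have hinj : Function.Injective x := fun i j hij => by
    have h1 := hx1 i; have h2 := hx2 i; have h3 := hx3 i
    have h1' := hx1 j; have h2' := hx2 j; have h3' := hx3 j
    rw [← hij] at h1' h2' h3'
    simp only [collapse] at h3 h3'
    ext
    split_ifs at h3 h3' <;> lia
  have := card_add_two_mul_card_le (E := E) (C := deadEndEdges (k + 1))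
    (X := Finset.univ.map ⟨x, hinj⟩) ?_ ?_
  · rwa [card_deadEndEdges, Finset.card_map, Finset.card_univ, Fintype.card_fin] at this
  · rintro ⟨e, l⟩ hel
    simp only [deadEndEdges, Finset.mem_biUnion, Finset.mem_map, Function.Embedding.coeFn_mk,
      Prod.mk.injEq] at hel
    obtain ⟨e, he, l, hl, rfl, rfl⟩ := hel
    rw [Finset.mem_Ico] at he
    rwa [h.odd_count, crossings_deadEnd he.1 he.2, Between.iff_mem]
  -- A rightward crossing at the gap `j` leaves the number of crossings of `e` above both `0` and
  -- its final value `-2 * collapse e`, since `|collapse e| < j`; a leftward one leaves it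
  -- below both.
  · simp only [Finset.mem_map, Finset.mem_univ, true_and, Function.Embedding.coeFn_mk]
    rintro _ ⟨j, rfl⟩
    refine ⟨hxE j, ?_⟩
    have h1 := hx1 j; have h2 := hx2 j; have h3 := hx3 j
    have hj : ((j : ℕ) : ℤ) < k := by exact_mod_cast j.isLt
    rw [← Prod.mk.eta (p := x j), h.odd_count, crossings_deadEnd (by lia) (by lia), Between]
    simp only [collapse] at h3 ⊢
    split_ifs at h3 ⊢ <;> lia

/-! ### Length and depth -/

lemma fixesOff_deadEnd (k : ℕ) : FixesOff (-k) k 0 (houghtonDeadEnd k) := fun y hy => by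
  rw [sub_zero, lineAction_deadEnd, if_neg (by lia)]

lemma wordLength_deadEnd (k : ℕ) :
    wordLength houghtonGens (houghtonDeadEnd (k + 1)) = 4 * k ^ 2 + 7 * k + 1 := by
  apply le_antisymm
  · exact (reach_of_fixesOff (fixesOff_deadEnd (k + 1)) (by simp)).wordLength_le
  · obtain ⟨w, hw, hg, hl⟩ := exists_word (houghtonDeadEnd (k + 1))
    obtain ⟨p, J, E, hL, hE⟩ := exists_ledger (k + 1) w hw
    rw [hg] at hL hE
    rw [card_discordant_deadEnd] at hE
    have h1 := hL.card_ge
    have h2 : 2 * (k + 1) * (2 * (k + 1)) = 4 * k ^ 2 + 6 * k + 2 + 2 * (k + 1) := by ring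
    rw [h2, Nat.add_sub_cancel] at hE
    rw [← hl]
    lia

lemma wordDist_one_left (g : Houghton 2) :
    wordDist houghtonGens 1 g = wordLength houghtonGens g := by
  rw [wordDist, inv_one, one_mul]

lemma ball_subset {k : ℕ} (hk : 1 ≤ k) {r : ℕ} (hr : r ≤ k + 1) :
    wordBall houghtonGens (houghtonDeadEnd (k + 1)) r ⊆
      wordBall houghtonGens 1 (wordDist houghtonGens 1 (houghtonDeadEnd (k + 1))) := by
  intro h hh
  change wordLength houghtonGens _ ≤ r at hh
  change wordDist houghtonGens 1 h ≤ _
  obtain ⟨w, hw, hg, hl⟩ := exists_word ((houghtonDeadEnd (k + 1))⁻¹ * h)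
  have := reach_mul_prod hk (fixesOff_deadEnd (k + 1)) w hw (by lia)
  rw [hg, mul_inv_cancel_left] at this
  rw [wordDist_one_left, wordDist_one_left, wordLength_deadEnd]
  exact this.wordLength_le

lemma isDeadEnd_and_le_depth {k : ℕ} (hk : 2 ≤ k) :
    IsDeadEnd houghtonGens (houghtonDeadEnd k) ∧
      (k : ℕ∞) ≤ deadEndDepth houghtonGens (houghtonDeadEnd k) := by
  obtain ⟨k, rfl⟩ : ∃ m, k = m + 1 := ⟨k - 1, by lia⟩
  exact ⟨ball_subset (by lia) (by lia), le_sSup ⟨k + 1, rfl, ball_subset (by lia) le_rfl⟩⟩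

lemma sum_eight_mul_sub_five (k : ℕ) :
    1 + ∑ l ∈ Finset.Icc 2 (k + 1), (8 * l - 5) = 4 * k ^ 2 + 7 * k + 1 := by
  induction k with
  | zero => rfl
  | succ k ih =>
    rw [Finset.sum_Icc_succ_top (by lia), ← add_assoc, ih]
    lia

theorem theorem3 :
    Subgroup.closure houghtonGens = ⊤ ∧
    (∀ k : ℕ, 1 ≤ k →
      wordDist houghtonGens 1 (houghtonDeadEnd k) = 1 + ∑ l ∈ Finset.Icc 2 k, (8 * l - 5)) ∧
    (∀ k : ℕ, 2 ≤ k →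
      IsDeadEnd houghtonGens (houghtonDeadEnd k) ∧
        (k : ℕ∞) ≤ deadEndDepth houghtonGens (houghtonDeadEnd k)) ∧
    (∀ N : ℕ, ∃ g : Houghton 2,
      IsDeadEnd houghtonGens g ∧ (N : ℕ∞) ≤ deadEndDepth houghtonGens g) := by
  refine ⟨closure_houghtonGens, fun k hk => ?_, fun k hk => isDeadEnd_and_le_depth hk,
    fun N => ⟨houghtonDeadEnd (N + 2), ?_⟩⟩
  · obtain ⟨k, rfl⟩ : ∃ m, k = m + 1 := ⟨k - 1, by lia⟩
    rw [wordDist_one_left, wordLength_deadEnd, sum_eight_mul_sub_five]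
  · have h := isDeadEnd_and_le_depth (k := N + 2) (by lia)
    exact ⟨h.1, le_trans (by exact_mod_cast Nat.le_add_right N 2) h.2⟩
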